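/- Let $\mathbb Z_+=\{0,1,2,\dots\}$ and $\mathbb N=\{1,2,\dots\}$. A probability distribution $P$ on $\mathbb Z_+$ is *log-concave* if its support is a (possibly infinite) interval of successive integers and $P(x)^2\ge P(x+1)P(x-1)$ for all $x\ge 1$. It is *ultra log-concave* if its support is a (possibly infinite) interval of successive integers and $x\,P(x)^2\ge (x+1)\,P(x+1)\,P(x-1)$ for all $x\ge1$. For a distribution $Q$ on $\mathbb N$ and a distribution $P$ on $\mathbb Z_+$, the $Q$-compound distribution $C_QP$ is $$C_QP(x)=\sum_{y\ge 0}P(y)\,Q^{*y}(x),\qquad x\in\mathbb Z_+,$$ where $Q^{*y}$ is the $y$-fold convolution power of $Q$ and $Q^{*0}$ is the point mass at $0$. For $\lambda>0$, let $\Pi_\lambda(x)=e^{-\lambda}\lambda^x/x!$ be the Poisson mass function, and let $\mathrm{CPo}(\lambda,Q)=C_Q\Pi_\lambda$ be the compound Poisson distribution. Let $H(P)=-\sum_xP(x)\log P(x)\in[0,\infty]$ denote the entropy, with $0\log 0=0$. **Theorem.** Let $\lambda>0$ and let $Q$ be a distribution on $\mathbb N$. If $Q$ and $\mathrm{CPo}(\lambda,Q)$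 are both log-concave, then $H(\mathrm{CPo}(\lambda,Q))$ is finite and $$H(\mathrm{CPo}(\lambda,Q))=\max\bigl\{H(C_QP)\;:\;P\text{ an ultra log-concave distribution on }\mathbb Z_+\text{ with mean }\lambda\bigr\}.$$ -/

import Mathlib

open scoped NNReal ENNReal

namespace CompoundEntropy

noncomputable section

/-- The convolution power `Q^{*n}`: the law of the sum of `n` i.i.d. random variables with
law `Q`; for `n = 0` it is the point mass at `0`. -/
def convPow (Q : PMF ℕ) : ℕ → PMF ℕ
  | 0 => PMF.pure 0
  | n + 1 => Q.bind fun x => (convPow Q n).map fun s => x + s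

/-- The `Q`-compound distribution `C_Q P`, the mixture `x ↦ ∑ y, P y * Q^{*y} x`, that is, the
law of `X₁ + ⋯ + X_Y` with `Y ∼ P` and `X_j ∼ Q` all independent. -/
def compound (Q P : PMF ℕ) : PMF ℕ := P.bind fun y => convPow Q y

/-- The compound Poisson distribution `CPo(r, Q) = C_Q Π_r`, where `Π_r` is the Poisson law with
mass function `x ↦ e^{-r} r^x / x!`. -/
def compoundPoisson (r : ℝ≥0) (Q : PMF ℕ) : PMF ℕ :=
  compound Q (ProbabilityTheory.poissonMeasure r).toPMF

/-- `P` is log-concave: its support is an interval of successive integers, and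
`P(x)² ≥ P(x+1) P(x-1)` for all `x ≥ 1`. -/
def IsLogConcave (P : PMF ℕ) : Prop :=
  P.support.OrdConnected ∧
    ∀ x : ℕ, 1 ≤ x → (P (x + 1)).toReal * (P (x - 1)).toReal ≤ (P x).toReal ^ 2

/-- `P` is ultra log-concave, i.e. its ratio to a Poisson mass function is log-concave:
its support is an interval of successive integers, and
`x P(x)² ≥ (x+1) P(x+1) P(x-1)` for all `x ≥ 1`. -/
def IsUltraLogConcave (P : PMF ℕ) : Prop :=
  P.support.OrdConnected ∧
    ∀ x : ℕ, 1 ≤ x →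
      ((x : ℝ) + 1) * (P (x + 1)).toReal * (P (x - 1)).toReal ≤ (x : ℝ) * (P x).toReal ^ 2

/-- The mean `∑ x, x P(x)`, as an element of `[0, ∞]`. -/
def mean (P : PMF ℕ) : ℝ≥0∞ := ∑' x : ℕ, (x : ℝ≥0∞) * P x

/-- The discrete entropy `H(P) = - ∑ x, P(x) log P(x)` (natural logarithm, `0 log 0 = 0`), a sum
of nonnegative terms taken in `[0, ∞]`. -/
def entropy (P : PMF ℕ) : ℝ≥0∞ := ∑' x : ℕ, ENNReal.ofReal (Real.negMulLog (P x).toReal)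

end

end CompoundEntropy

/-! Write `G = -log CPo(λ,Q)`. Gibbs' inequality (`entropy_le_tsum`) bounds `H(C_Q P)` by the mean
of `G` under `C_Q P`, with equality when `P` is Poisson. That mean is `E h(Y)`, where `Y ∼ P`, `h n
= E G(S_n)` and `S_n` is a sum of `n` independent draws from `Q`, so it suffices that `E h(Y)` is
largest for Poisson `Y`. Two facts give this. Log-concavity of `CPo(λ,Q)` makes `G` convex, hence
supermodular, and so `h` is convex (`two_mul_tsum_convPow_le`). If `P` is ultra log-concave, its
ratio to the Poisson law is log-concave, so `P` dominates that law exactly on an interval; with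
equal means, this puts `P` below it in the convex order (`tsum_mul_le_tsum_poisson_mul`). Finiteness
holds because a log-concave law of full support has a geometric tail. -/

namespace CompoundEntropy

/-! ### Convex sequences -/

section ConvexSequence

variable {f : ℕ → ℝ}

lemma log_add_log_le_two_mul_log {a b c : ℝ} (ha : 0 < a) (hc : 0 < c)
    (h : a * c ≤ b ^ 2) : Real.log a + Real.log c ≤ 2 * Real.log b := by
  rw [← Real.log_mul ha.ne' hc.ne']
  calc Real.log (a * c) ≤ Real.log (b ^ 2) := Real.log_le_log (mul_pos ha hc) h
    _ = 2 * Real.log b := by rw [Real.log_pow]; norm_num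

/-- The increments of a sequence that is convex on `[i, k]` are nondecreasing there. -/
lemma increment_mono {i k : ℕ}
    (hf : ∀ y, i ≤ y → y + 2 ≤ k → 2 * f (y + 1) ≤ f y + f (y + 2)) (n : ℕ) {y : ℕ}
    (hy : i ≤ y) (hk : y + n + 1 ≤ k) : f (y + 1) - f y ≤ f (y + n + 1) - f (y + n) := by
  induction n with
  | zero => simp
  | succ n ih =>
    have h1 := ih (by omega)
    have h2 := hf (y + n) (by omega) (by omega)
    rw [show y + (n + 1) + 1 = y + n + 2 by ring, show y + (n + 1) = y + n + 1 by ring]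
    linarith

/-- A sequence that is convex on `[i, k]` lies below its chord there. -/
lemma le_chord {i j k : ℕ} (hij : i ≤ j) (hjk : j ≤ k)
    (hf : ∀ y, i ≤ y → y + 2 ≤ k → 2 * f (y + 1) ≤ f y + f (y + 2)) :
    ((k : ℝ) - i) * f j ≤ (k - j) * f i + (j - i) * f k := by
  rcases hjk.eq_or_lt with rfl | hjk
  · linarith
  -- The increment at `j` bounds all earlier increments from above and all later ones from below.
  have hleft : ∀ n, i + n ≤ j → f (i + n) - f i ≤ n * (f (j + 1) - f j) := by
    intro n
    induction n with
    | zero => simp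
    | succ n ih =>
      intro hn
      have h1 := ih (by omega)
      have h2 := increment_mono hf (j - (i + n)) (y := i + n) (by omega) (by omega)
      rw [Nat.add_sub_cancel' (by omega : i + n ≤ j)] at h2
      rw [← add_assoc]
      push_cast
      linarith
  have hright : ∀ n, j + n ≤ k → n * (f (j + 1) - f j) ≤ f (j + n) - f j := by
    intro n
    induction n with
    | zero => simp
    | succ n ih =>
      intro hn
      have h1 := ih (by omega)
      have h2 := increment_mono hf n hij (by omega)
      rw [← add_assoc]
      push_cast
      linarith
  have hl := hleft (j - i) (by omega)
  have hr := hright (k - j) (by omega)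
  rw [Nat.add_sub_cancel' hij, Nat.cast_sub hij] at hl
  rw [Nat.add_sub_cancel' hjk.le, Nat.cast_sub hjk.le] at hr
  have ha : (0 : ℝ) ≤ j - i := sub_nonneg.2 (Nat.cast_le.2 hij)
  have hb : (0 : ℝ) ≤ k - j := sub_nonneg.2 (Nat.cast_le.2 hjk.le)
  nlinarith [mul_le_mul_of_nonneg_left hl hb, mul_le_mul_of_nonneg_left hr ha]

/-- A convex sequence crosses some affine function at the ends of a given interval. -/
lemma exists_affine_crossing (hf : ∀ y, 2 * f (y + 1) ≤ f y + f (y + 2)) {a b : ℕ} (hab : a ≤ b) :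
    ∃ α β : ℝ, (∀ y, a ≤ y → y ≤ b → f y ≤ α * y + β) ∧
      ∀ y, y < a ∨ b < y → α * y + β ≤ f y := by
  -- The affine function is the chord over `[a, c]`. Taking `c = a + 1` when `a = b` keeps it
  -- nondegenerate, and no integer beyond `b` lies below `c`.
  obtain ⟨c, hac, hbc, hc⟩ : ∃ c, a < c ∧ b ≤ c ∧ ∀ y, b < y → c ≤ y :=
    ⟨max b (a + 1), by omega, by omega, by omega⟩
  have hac' : (0 : ℝ) < c - a := sub_pos.2 (Nat.cast_lt.2 hac)
  have key : ∀ y : ℕ, (f c - f a) / (c - a) * y + (f a - (f c - f a) / (c - a) * a) =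
      ((c - y) * f a + (y - a) * f c) / (c - a) := by
    intro y
    field_simp
    ring
  refine ⟨(f c - f a) / (c - a), f a - (f c - f a) / (c - a) * a, fun y hay hyb => ?_,
    fun y hy => ?_⟩
  · rw [key, le_div_iff₀ hac']
    linarith [le_chord hay (hyb.trans hbc) fun y _ _ => hf y]
  · rw [key, div_le_iff₀ hac']
    rcases hy with hy | hy
    · linarith [le_chord hy.le hac.le fun y _ _ => hf y]
    · linarith [le_chord hac.le (hc y hy) fun y _ _ => hf y]

/-- A convex sequence is supermodular. -/
lemma add_le_add_of_convex (hf : ∀ y, 2 * f (y + 1) ≤ f y + f (y + 2)) (s a b : ℕ) :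
    f (a + s) + f (b + s) ≤ f s + f (a + (b + s)) := by
  induction a with
  | zero => simp
  | succ a ih =>
    have := increment_mono (k := s + a + b + 1) (fun y _ _ => hf y) b (y := s + a) le_rfl le_rfl
    rw [show a + 1 + s = s + a + 1 by ring, show a + 1 + (b + s) = s + a + b + 1 by ring]
    rw [show a + s = s + a by ring, show a + (b + s) = s + a + b by ring] at ih
    linarith

end ConvexSequence

/-! ### The convex order -/

/-- Two mass functions with the same mean, one of which dominates the other exactly on an
interval, are comparable in the convex order. -/
lemma tsum_mul_le_of_ordConnected {p q h : ℕ → ℝ} {m : ℝ} (hp : HasSum p 1) (hq : HasSum q 1)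
    (hpm : HasSum (fun y : ℕ => (y : ℝ) * p y) m) (hqm : HasSum (fun y : ℕ => (y : ℝ) * q y) m)
    (hp0 : ∀ y, 0 ≤ p y) (hA : {y | q y ≤ p y}.OrdConnected) (hh0 : ∀ y, 0 ≤ h y)
    (hh : ∀ y, 2 * h (y + 1) ≤ h y + h (y + 2)) (hqh : Summable fun y => q y * h y) :
    (Summable fun y => p y * h y) ∧ ∑' y, p y * h y ≤ ∑' y, q y * h y := by
  have haff : ∀ α β : ℝ, HasSum (fun y : ℕ => (p y - q y) * (α * y + β)) 0 := by
    intro α β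
    convert! ((hpm.sub hqm).mul_left α).add ((hp.sub hq).mul_left β) using 1
    · ext y
      ring
    · ring
  have hne : {y | q y ≤ p y}.Nonempty := by
    by_contra hempty
    rw [Set.not_nonempty_iff_eq_empty, Set.eq_empty_iff_forall_notMem] at hempty
    have hlt : ∀ y, p y < q y := fun y => not_le.1 (hempty y)
    exact lt_irrefl _ (hasSum_lt (fun y => (hlt y).le) (hlt 0) hp hq)
  set a := sInf {y | q y ≤ p y} with ha
  have haA : q a ≤ p a := Nat.sInf_mem hne
  have hamin : ∀ y, y < a → p y < q y := fun y hy => not_le.1 (Nat.notMem_of_lt_sInf hy)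
  by_cases hbdd : BddAbove {y | q y ≤ p y}
  · have hbA := Nat.sSup_mem hne hbdd
    set b := sSup {y | q y ≤ p y} with hb
    obtain ⟨α, β, hin, hout⟩ := exists_affine_crossing hh (Nat.sInf_le hbA)
    -- The affine term has total `0` by equality of masses and means; `p - q` and the affine
    -- function minus `h` never have opposite signs.
    have hle : ∀ y, p y * h y ≤ q y * h y + (p y - q y) * (α * y + β) := by
      intro y
      suffices 0 ≤ (p y - q y) * (α * y + β - h y) by linarith
      by_cases hy : a ≤ y ∧ y ≤ b
      · exact mul_nonneg (sub_nonneg.2 (hA.out haA hbA ⟨hy.1, hy.2⟩))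
          (sub_nonneg.2 (hin y hy.1 hy.2))
      · have hy' : y < a ∨ b < y := by omega
        have hyA : p y < q y := by
          rcases hy' with hy' | hy'
          · exact hamin y hy'
          · exact not_le.1 fun hmem => absurd (le_csSup hbdd hmem) (not_le.2 hy')
        exact mul_nonneg_of_nonpos_of_nonpos (sub_nonpos.2 hyA.le) (sub_nonpos.2 (hout y hy'))
    have hsum := hqh.add (haff α β).summable
    have hph : Summable fun y => p y * h y :=
      .of_nonneg_of_le (fun y => mul_nonneg (hp0 y) (hh0 y)) hle hsum
    refine ⟨hph, (hph.tsum_le_tsum hle hsum).trans_eq ?_⟩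
    rw [hqh.tsum_add (haff α β).summable, (haff α β).tsum_eq, add_zero]
  · -- all the excess of `p` lies above all its deficit, so equality of means forces `p = q`
    have hnn : ∀ y : ℕ, 0 ≤ (p y - q y) * (1 * y + (1 / 2 - a)) := by
      intro y
      rcases lt_or_ge y a with hy | hy
      · have : (y : ℝ) + 1 ≤ a := by exact_mod_cast hy
        exact mul_nonneg_of_nonpos_of_nonpos (sub_nonpos.2 (hamin y hy).le) (by linarith)
      · obtain ⟨z, hz, hyz⟩ := not_bddAbove_iff.1 hbdd y
        have : (a : ℝ) ≤ y := by exact_mod_cast hy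
        exact mul_nonneg (sub_nonneg.2 (hA.out haA hz ⟨hy, hyz.le⟩)) (by linarith)
    -- The shift by `1/2` keeps the affine factor from vanishing at an integer.
    have hzero := (hasSum_zero_iff_of_nonneg hnn).1 (haff 1 (1 / 2 - a))
    have heq : p = q := by
      ext y
      rcases mul_eq_zero.1 (congrFun hzero y) with hy | hy
      · exact sub_eq_zero.1 hy
      · exfalso
        have h2 : (2 * y + 1 : ℝ) = 2 * a := by linarith
        have h3 : 2 * y + 1 = 2 * a := by exact_mod_cast h2
        omega
    subst heq
    exact ⟨hqh, le_rfl⟩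

/-- A log-concave density with respect to a Poisson mass function is at least `1` on an
interval. -/
lemma ordConnected_poisson_le {p q : ℕ → ℝ} {r : ℝ} (hq0 : ∀ y, 0 < q y)
    (hq : ∀ y : ℕ, ((y : ℝ) + 1) * q (y + 1) = r * q y) (hp0 : ∀ y, 0 ≤ p y)
    (hsupp : {y | p y ≠ 0}.OrdConnected)
    (hp : ∀ x : ℕ, 1 ≤ x → ((x : ℝ) + 1) * p (x + 1) * p (x - 1) ≤ (x : ℝ) * p x ^ 2) :
    {y | q y ≤ p y}.OrdConnected := by
  refine ⟨fun i hi k hk j hj => ?_⟩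
  have hpos : ∀ y, i ≤ y → y ≤ k → 0 < p y := fun y h1 h2 =>
    (hp0 y).lt_of_ne' (hsupp.out ((hq0 i).trans_le hi).ne' ((hq0 k).trans_le hk).ne' ⟨h1, h2⟩)
  have hconv : ∀ y, i ≤ y → y + 2 ≤ k → 2 * (-Real.log (p (y + 1) / q (y + 1))) ≤
      -Real.log (p y / q y) + -Real.log (p (y + 2) / q (y + 2)) := by
    intro y hiy hyk
    have h0 := hpos y hiy (by omega)
    have h1 := hpos (y + 1) (by omega) (by omega)
    have h2 := hpos (y + 2) (by omega) hyk
    have hulc := hp (y + 1) (by omega)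
    have hq1 := hq y
    have hq2 := hq (y + 1)
    simp only [add_assoc, Nat.reduceAdd, Nat.add_sub_cancel] at hulc hq2
    push_cast at hulc hq2
    -- The Poisson recursion gives equality in the ultra log-concavity condition.
    have hqq : ((y : ℝ) + 2) * (q y * q (y + 2)) = (y + 1) * q (y + 1) ^ 2 := by
      rcases eq_or_ne r 0 with rfl | hr
      · have := mul_pos (by positivity : (0 : ℝ) < y + 1) (hq0 (y + 1))
        linarith
      · apply mul_left_cancel₀ hr
        linear_combination (-((y : ℝ) + 2) * q (y + 2)) * hq1 + ((y : ℝ) + 1) * q (y + 1) * hq2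
    have key : p y / q y * (p (y + 2) / q (y + 2)) ≤ (p (y + 1) / q (y + 1)) ^ 2 := by
      have hqy := hq0 y
      have hqy2 := hq0 (y + 2)
      rw [div_mul_div_comm, div_pow, div_le_div_iff₀ (by positivity) (pow_pos (hq0 _) 2)]
      refine le_of_mul_le_mul_left ?_ (by positivity : (0 : ℝ) < (y + 1) * (y + 2))
      have hy2 : (0 : ℝ) ≤ y + 2 := by positivity
      calc ((y : ℝ) + 1) * (y + 2) * (p y * p (y + 2) * q (y + 1) ^ 2)
          = (((y : ℝ) + 2) * p (y + 2) * p y) * ((y + 1) * q (y + 1) ^ 2) := by ring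
        _ ≤ (((y : ℝ) + 1) * p (y + 1) ^ 2) * ((y + 1) * q (y + 1) ^ 2) := by
            refine mul_le_mul_of_nonneg_right ?_ (by positivity)
            linarith
        _ = (y + 1) * (y + 2) * (p (y + 1) ^ 2 * (q y * q (y + 2))) := by
            rw [← hqq]; ring
    have := log_add_log_le_two_mul_log (div_pos h0 (hq0 _)) (div_pos h2 (hq0 _))
      key
    linarith
  -- The convex sequence `-log (p/q)` is nonpositive at `i` and `k`, hence at `j`.
  have hchord := le_chord (f := fun y => -Real.log (p y / q y)) hj.1 hj.2 hconv
  have hlog : ∀ y, q y ≤ p y → 0 ≤ Real.log (p y / q y) := fun y hy =>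
    Real.log_nonneg ((one_le_div (hq0 y)).2 hy)
  have hij : (i : ℝ) ≤ j := Nat.cast_le.2 hj.1
  have hjk : (j : ℝ) ≤ k := Nat.cast_le.2 hj.2
  change q j ≤ p j
  by_contra hlt
  have hneg : Real.log (p j / q j) < 0 :=
    Real.log_neg (div_pos (hpos j hj.1 hj.2) (hq0 j)) ((div_lt_one (hq0 j)).2 (not_le.1 hlt))
  have hik : (i : ℝ) < k := by
    refine lt_of_le_of_ne (hij.trans hjk) fun h => ?_
    have : i = k := by exact_mod_cast h
    have : i = j := le_antisymm hj.1 (by have := hj.2; omega)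
    exact hlt (this ▸ hi)
  nlinarith [mul_nonneg (sub_nonneg.2 hjk) (hlog i hi), mul_nonneg (sub_nonneg.2 hij) (hlog k hk),
    mul_pos (sub_pos.2 hik) (neg_pos.2 hneg)]

/-! ### Expectations of `[0, ∞]`-valued functions -/

lemma tsum_bind_mul {α β : Type*} (p : PMF α) (f : α → PMF β) (G : β → ℝ≥0∞) :
    ∑' x, p.bind f x * G x = ∑' y, p y * ∑' x, f y x * G x := by
  simp_rw [PMF.bind_apply, ← ENNReal.tsum_mul_right, ← ENNReal.tsum_mul_left]
  rw [ENNReal.tsum_comm]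
  simp_rw [mul_assoc]

lemma tsum_pure_mul {α : Type*} (a : α) (G : α → ℝ≥0∞) : ∑' x, PMF.pure a x * G x = G a := by
  rw [tsum_eq_single a fun x hx => by simp [hx]]
  simp

lemma tsum_map_mul {α β : Type*} (p : PMF α) (f : α → β) (G : β → ℝ≥0∞) :
    ∑' x, p.map f x * G x = ∑' y, p y * G (f y) := by
  rw [PMF.map, tsum_bind_mul]
  simp_rw [Function.comp_apply, tsum_pure_mul]

lemma tsum_mul_const {α : Type*} (p : PMF α) (c : ℝ≥0∞) : ∑' x, p x * c = c := by
  rw [ENNReal.tsum_mul_right, p.tsum_coe, one_mul]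

lemma tsum_convPow_succ_mul (Q : PMF ℕ) (n : ℕ) (G : ℕ → ℝ≥0∞) :
    ∑' x, convPow Q (n + 1) x * G x = ∑' x, Q x * ∑' s, convPow Q n s * G (x + s) := by
  rw [convPow, tsum_bind_mul]
  simp_rw [tsum_map_mul]

/-- The expectation of a supermodular function of a random walk is a convex sequence. -/
lemma two_mul_tsum_convPow_le (Q : PMF ℕ) {G : ℕ → ℝ≥0∞}
    (hG : ∀ s a b, G (a + s) + G (b + s) ≤ G s + G (a + (b + s))) (n : ℕ) :
    2 * ∑' x, convPow Q (n + 1) x * G x ≤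
      ∑' x, convPow Q n x * G x + ∑' x, convPow Q (n + 2) x * G x := by
  -- All expectations are taken over one triple: independent steps `a`, `b` and the walk `s` at time
  -- `n`. By exchangeability `a + s` and `b + s` both have the law at time `n + 1`.
  have h1 : ∑' x, convPow Q (n + 1) x * G x =
      ∑' a, Q a * ∑' b, Q b * ∑' s, convPow Q n s * G (a + s) := by
    simp_rw [tsum_mul_const, tsum_convPow_succ_mul]
  have h1' : ∑' x, convPow Q (n + 1) x * G x =
      ∑' a, Q a * ∑' b, Q b * ∑' s, convPow Q n s * G (b + s) := by
    rw [tsum_mul_const, tsum_convPow_succ_mul]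
  have h0 : ∑' x, convPow Q n x * G x =
      ∑' a, Q a * ∑' b, Q b * ∑' s, convPow Q n s * G s := by
    simp_rw [tsum_mul_const]
  have h2 : ∑' x, convPow Q (n + 2) x * G x =
      ∑' a, Q a * ∑' b, Q b * ∑' s, convPow Q n s * G (a + (b + s)) := by
    simp_rw [tsum_convPow_succ_mul]
  rw [two_mul, h2, h0]
  nth_rw 1 [h1]
  rw [h1']
  simp_rw [← ENNReal.tsum_add, ← mul_add, ← ENNReal.tsum_add, ← mul_add, ← ENNReal.tsum_add,
    ← mul_add]
  exact ENNReal.tsum_le_tsum fun a => mul_le_mul_right (ENNReal.tsum_le_tsum fun b =>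
    mul_le_mul_right (ENNReal.tsum_le_tsum fun s => mul_le_mul_right (hG s a b) _) _) _

/-! ### Entropy -/

lemma toReal_le_one (P : PMF ℕ) (x : ℕ) : (P x).toReal ≤ 1 :=
  ENNReal.toReal_le_of_le_ofReal zero_le_one (by simpa using P.coe_le_one x)

lemma hasSum_toReal (P : PMF ℕ) : HasSum (fun x => (P x).toReal) 1 := by
  have := ENNReal.hasSum_toReal P.tsum_coe_ne_top
  rwa [← ENNReal.tsum_toReal_eq P.apply_ne_top, P.tsum_coe, ENNReal.toReal_one] at this

lemma neg_log_nonneg (P : PMF ℕ) (x : ℕ) : 0 ≤ -Real.log (P x).toReal :=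
  neg_nonneg.2 (Real.log_nonpos ENNReal.toReal_nonneg (toReal_le_one P x))

lemma entropy_eq_tsum (P : PMF ℕ) :
    entropy P = ∑' x, P x * ENNReal.ofReal (-Real.log (P x).toReal) := by
  refine tsum_congr fun x => ?_
  rw [Real.negMulLog, neg_mul_comm, ENNReal.ofReal_mul ENNReal.toReal_nonneg,
    ENNReal.ofReal_toReal (P.apply_ne_top x)]

/-- Gibbs' inequality, for a reference distribution of full support. -/
lemma entropy_le_tsum (P R : PMF ℕ) (hR : ∀ x, 0 < (R x).toReal) :
    entropy P ≤ ∑' x, P x * ENNReal.ofReal (-Real.log (R x).toReal) := by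
  -- Adding `P x` and `R x` avoids subtraction in `[0, ∞]`; both total `1` and cancel after
  -- summation.
  have key : ∀ x, ENNReal.ofReal (Real.negMulLog (P x).toReal) + P x ≤
      P x * ENNReal.ofReal (-Real.log (R x).toReal) + R x := by
    intro x
    have hp : 0 ≤ (P x).toReal := ENNReal.toReal_nonneg
    have hpe := ENNReal.ofReal_toReal (P.apply_ne_top x)
    have hre := ENNReal.ofReal_toReal (R.apply_ne_top x)
    have hlog := neg_log_nonneg R x
    have hpr := hR x
    generalize (P x).toReal = p at *
    generalize (R x).toReal = c at *
    have hp1 : 0 ≤ Real.negMulLog p := by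
      have : p ≤ 1 := by
        rw [← ENNReal.ofReal_le_one, hpe]
        exact P.coe_le_one x
      exact Real.negMulLog_nonneg hp this
    rw [← hpe, ← hre, ← ENNReal.ofReal_mul hp, ← ENNReal.ofReal_add hp1 hp,
      ← ENNReal.ofReal_add (mul_nonneg hp hlog) hpr.le]
    apply ENNReal.ofReal_le_ofReal
    rcases hp.eq_or_lt with rfl | hp
    · simpa using hpr.le
    · have h1 := Real.log_le_sub_one_of_pos (div_pos hpr hp)
      rw [Real.log_div hpr.ne' hp.ne'] at h1
      have h2 := mul_le_mul_of_nonneg_left h1 hp.le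
      rw [mul_sub, mul_sub, mul_div_cancel₀ _ hp.ne'] at h2
      rw [Real.negMulLog]
      linarith
  have hsum := ENNReal.tsum_le_tsum key
  rw [ENNReal.tsum_add, ENNReal.tsum_add, P.tsum_coe, R.tsum_coe] at hsum
  exact (ENNReal.add_le_add_iff_right ENNReal.one_ne_top).1 hsum

lemma two_mul_neg_log_le {P : PMF ℕ} (hP : IsLogConcave P) (hpos : ∀ x, 0 < (P x).toReal)
    (y : ℕ) : 2 * (-Real.log (P (y + 1)).toReal) ≤
      -Real.log (P y).toReal + -Real.log (P (y + 2)).toReal := by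
  have h := hP.2 (y + 1) (by omega)
  simp only [add_assoc, Nat.reduceAdd, Nat.add_sub_cancel] at h
  rw [mul_comm] at h
  linarith [log_add_log_le_two_mul_log (hpos y) (hpos (y + 2)) h]

/-- With `t = -log p` this bounds `-p log p` by `2√p`, which is summable under a geometric tail. -/
lemma exp_neg_mul_le (t : ℝ) : t * Real.exp (-t) ≤ 2 * Real.exp (-(t / 2)) := by
  have h1 : t ≤ 2 * Real.exp (t / 2) := by linarith [Real.add_one_le_exp (t / 2)]
  calc t * Real.exp (-t) ≤ 2 * Real.exp (t / 2) * Real.exp (-t) := by gcongr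
    _ = 2 * Real.exp (-(t / 2)) := by
      rw [mul_assoc, ← Real.exp_add]
      ring_nf

/-- A log-concave distribution of full support has finite entropy. -/
lemma entropy_ne_top {P : PMF ℕ} (hP : IsLogConcave P) (hpos : ∀ x, 0 < (P x).toReal) :
    entropy P ≠ ∞ := by
  set g : ℕ → ℝ := fun x => -Real.log (P x).toReal with hg
  have hconv : ∀ y, 2 * g (y + 1) ≤ g y + g (y + 2) := two_mul_neg_log_le hP hpos
  have hexp : ∀ x, (P x).toReal = Real.exp (-g x) := fun x => by
    simp [hg, Real.exp_log (hpos x)]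
  -- Otherwise every mass is at least `P 0 > 0`, contradicting summability. From `a` on, convexity
  -- forces linear growth of `g`.
  obtain ⟨a, ha⟩ : ∃ a, g a < g (a + 1) := by
    by_contra! hanti
    have hle : ∀ n, g n ≤ g 0 := fun n => antitone_nat_of_succ_le hanti (Nat.zero_le n)
    have hlim := (hasSum_toReal P).summable.tendsto_atTop_zero
    have := ge_of_tendsto' hlim (b := (P 0).toReal) fun n => by
      rw [hexp, hexp]
      exact Real.exp_le_exp.2 (neg_le_neg (hle n))
    exact absurd (hpos 0) (not_lt.2 this)
  have hlin : ∀ n : ℕ, g a + n * (g (a + 1) - g a) ≤ g (n + a) := by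
    intro n
    induction n with
    | zero => simp
    | succ n ih =>
      have h := increment_mono (k := a + n + 1) (fun y _ _ => hconv y) n (y := a) le_rfl le_rfl
      rw [show n + 1 + a = a + n + 1 by ring]
      rw [show n + a = a + n by ring] at ih
      push_cast
      linarith
  refine Summable.tsum_ofReal_ne_top ((summable_nat_add_iff a).1 ?_)
  set d := g (a + 1) - g a with hd
  have hdpos : 0 < d := sub_pos.2 ha
  have hgeom : Summable fun n : ℕ => 2 * Real.exp (-(g a / 2)) * Real.exp (-(d / 2)) ^ n :=
    (summable_geometric_of_lt_one (Real.exp_pos _).le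
      (Real.exp_lt_one_iff.2 (by linarith))).mul_left _
  refine .of_nonneg_of_le
    (fun n => Real.negMulLog_nonneg ENNReal.toReal_nonneg (toReal_le_one P _)) (fun n => ?_) hgeom
  calc Real.negMulLog (P (n + a)).toReal = g (n + a) * Real.exp (-g (n + a)) := by
        rw [← hexp, Real.negMulLog, hg]; ring
    _ ≤ 2 * Real.exp (-(g (n + a) / 2)) := exp_neg_mul_le _
    _ ≤ 2 * Real.exp (-((g a + n * d) / 2)) := by
        gcongr
        exact hlin n
    _ = 2 * Real.exp (-(g a / 2)) * Real.exp (-(d / 2)) ^ n := by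
        rw [← Real.exp_nat_mul, mul_assoc, ← Real.exp_add]
        ring_nf

/-! ### The Poisson distribution -/

lemma toReal_poisson_apply (r : ℝ≥0) (n : ℕ) :
    ((ProbabilityTheory.poissonMeasure r).toPMF n).toReal =
      Real.exp (-r) * r ^ n / n.factorial := by
  rw [MeasureTheory.Measure.toPMF_apply, ProbabilityTheory.poissonMeasure_singleton,
    ENNReal.toReal_ofReal (by positivity)]

lemma toReal_poisson_pos {r : ℝ≥0} (hr : 0 < r) (n : ℕ) :
    0 < ((ProbabilityTheory.poissonMeasure r).toPMF n).toReal := by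
  rw [toReal_poisson_apply]
  positivity

lemma succ_mul_toReal_poisson (r : ℝ≥0) (n : ℕ) :
    ((n : ℝ) + 1) * ((ProbabilityTheory.poissonMeasure r).toPMF (n + 1)).toReal =
      r * ((ProbabilityTheory.poissonMeasure r).toPMF n).toReal := by
  rw [toReal_poisson_apply, toReal_poisson_apply, Nat.factorial_succ]
  push_cast
  field_simp
  ring

lemma mean_poisson (r : ℝ≥0) : mean (ProbabilityTheory.poissonMeasure r).toPMF = r := by
  set p := (ProbabilityTheory.poissonMeasure r).toPMF with hp
  have h : ∀ n : ℕ, ((n + 1 : ℕ) : ℝ≥0∞) * p (n + 1) = r * p n := by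
    intro n
    rw [← ENNReal.toReal_eq_toReal_iff'
      (ENNReal.mul_ne_top (ENNReal.natCast_ne_top _) (p.apply_ne_top _))
      (ENNReal.mul_ne_top ENNReal.coe_ne_top (p.apply_ne_top _)), ENNReal.toReal_mul,
      ENNReal.toReal_mul]
    rw [ENNReal.toReal_natCast, ENNReal.coe_toReal]
    exact_mod_cast succ_mul_toReal_poisson r n
  rw [mean, tsum_eq_zero_add' ENNReal.summable]
  simp_rw [h]
  rw [ENNReal.tsum_mul_left, p.tsum_coe]
  simp

lemma isUltraLogConcave_poisson {r : ℝ≥0} (hr : 0 < r) :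
    IsUltraLogConcave (ProbabilityTheory.poissonMeasure r).toPMF := by
  constructor
  · convert Set.ordConnected_univ
    exact Set.eq_univ_of_forall fun n hn => (toReal_poisson_pos hr n).ne' (by rw [hn]; rfl)
  · intro x hx
    obtain ⟨n, rfl⟩ := Nat.exists_eq_add_of_le' hx
    have h1 := succ_mul_toReal_poisson r n
    have h2 := succ_mul_toReal_poisson r (n + 1)
    rw [Nat.add_sub_cancel]
    push_cast at h2 ⊢
    apply le_of_eq
    rw [h2]
    linear_combination (-((ProbabilityTheory.poissonMeasure r).toPMF (n + 1)).toReal) * h1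

/-- A convex function has the largest expectation under the Poisson law among ultra log-concave
laws of the same mean. -/
lemma tsum_mul_le_tsum_poisson_mul {r : ℝ≥0} (hr : 0 < r) {P : PMF ℕ} (hP : IsUltraLogConcave P)
    (hmean : mean P = r) {h : ℕ → ℝ≥0∞} (hh : ∀ y, 2 * h (y + 1) ≤ h y + h (y + 2)) :
    ∑' y, P y * h y ≤ ∑' y, (ProbabilityTheory.poissonMeasure r).toPMF y * h y := by
  have hRmean := mean_poisson r
  have hRpos := toReal_poisson_pos hr
  have hRrec := succ_mul_toReal_poisson r
  generalize (ProbabilityTheory.poissonMeasure r).toPMF = R at *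
  by_cases htop : ∑' y, R y * h y = ∞
  · simp [htop]
  -- Every Poisson mass is positive, so a finite expectation makes `h` finite everywhere and the
  -- comparison can be made in `ℝ`.
  have hfin : ∀ y, h y ≠ ∞ := fun y hy => by
    refine ENNReal.ne_top_of_tsum_ne_top htop y ?_
    rw [hy, ENNReal.mul_top fun h0 => (hRpos y).ne' (by rw [h0]; rfl)]
  have hms : ∀ S : PMF ℕ, mean S = r → HasSum (fun y : ℕ => (y : ℝ) * (S y).toReal) r := by
    intro S hS
    have hS' : ∑' y : ℕ, (y : ℝ≥0∞) * S y = r := hS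
    have := ENNReal.hasSum_toReal (hS' ▸ ENNReal.coe_ne_top)
    rw [← ENNReal.tsum_toReal_eq fun y =>
      ENNReal.mul_ne_top (ENNReal.natCast_ne_top y) (S.apply_ne_top y), hS'] at this
    simpa using this
  have hA := ordConnected_poisson_le (p := fun y => (P y).toReal) hRpos hRrec
    (fun y => ENNReal.toReal_nonneg) (by
      convert hP.1 using 1
      ext y
      simp [ENNReal.toReal_eq_zero_iff, P.apply_ne_top]) hP.2
  have hsumm := ENNReal.summable_toReal htop
  simp only [ENNReal.toReal_mul] at hsumm
  obtain ⟨h1, h2⟩ := tsum_mul_le_of_ordConnected (hasSum_toReal P) (hasSum_toReal R) (hms P hmean)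
    (hms R hRmean) (fun y => ENNReal.toReal_nonneg) hA (h := fun y => (h y).toReal)
    (fun y => ENNReal.toReal_nonneg) (fun y => by
      have := ENNReal.toReal_mono (ENNReal.add_ne_top.2 ⟨hfin _, hfin _⟩) (hh y)
      rwa [ENNReal.toReal_mul, ENNReal.toReal_add (hfin _) (hfin _)] at this) hsumm
  have hofReal : ∀ S : PMF ℕ, Summable (fun y => (S y).toReal * (h y).toReal) →
      ∑' y, S y * h y = ENNReal.ofReal (∑' y, (S y).toReal * (h y).toReal) := by
    intro S hS
    rw [ENNReal.ofReal_tsum_of_nonneg (fun y => by positivity) hS]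
    refine tsum_congr fun y => ?_
    rw [← ENNReal.toReal_mul,
      ENNReal.ofReal_toReal (ENNReal.mul_ne_top (S.apply_ne_top y) (hfin y))]
  rw [hofReal P h1, hofReal R hsumm]
  exact ENNReal.ofReal_le_ofReal h2

/-! ### Compound Poisson distributions -/

lemma mul_mem_support_convPow {Q : PMF ℕ} {x : ℕ} (hx : x ∈ Q.support) (n : ℕ) :
    n * x ∈ (convPow Q n).support := by
  induction n with
  | zero => simp [convPow]
  | succ n ih =>
    rw [convPow, PMF.mem_support_bind_iff]
    refine ⟨x, hx, ?_⟩
    rw [PMF.mem_support_map_iff]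
    exact ⟨_, ih, by ring⟩

/-- The support is an interval containing every multiple of some `a ≥ 1` charged by `Q`, including
`0`. -/
lemma toReal_compoundPoisson_pos {Q : PMF ℕ} (hQ0 : Q 0 = 0) {r : ℝ≥0} (hr : 0 < r)
    (hCPo : (compoundPoisson r Q).support.OrdConnected) (x : ℕ) :
    0 < (compoundPoisson r Q x).toReal := by
  obtain ⟨a, ha⟩ := Q.support_nonempty
  have ha0 : a ≠ 0 := fun h => ha (h ▸ hQ0)
  have hmem : ∀ n, n * a ∈ (compoundPoisson r Q).support := by
    intro n
    rw [compoundPoisson, compound, PMF.mem_support_bind_iff]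
    exact ⟨n, fun h => (toReal_poisson_pos hr n).ne' (by rw [h]; rfl),
      mul_mem_support_convPow ha n⟩
  have hx := hCPo.out (hmem 0) (hmem x)
    ⟨by simp, Nat.le_mul_of_pos_right x (Nat.pos_of_ne_zero ha0)⟩
  exact ENNReal.toReal_pos hx (PMF.apply_ne_top _ _)

end CompoundEntropy

open CompoundEntropy in
theorem theorem1p5 (Q : PMF ℕ) (hQ0 : Q 0 = 0) (r : ℝ≥0) (hr : 0 < r)
    (hQ : IsLogConcave Q) (hCPo : IsLogConcave (compoundPoisson r Q)) :
    entropy (compoundPoisson r Q) ≠ ∞ ∧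
      IsGreatest
        {h : ℝ≥0∞ | ∃ P : PMF ℕ, IsUltraLogConcave P ∧ mean P = r ∧ h = entropy (compound Q P)}
        (entropy (compoundPoisson r Q)) := by
  have hpos := toReal_compoundPoisson_pos hQ0 hr hCPo.1
  refine ⟨entropy_ne_top hCPo hpos, ⟨_, isUltraLogConcave_poisson hr, mean_poisson r, rfl⟩, ?_⟩
  rintro _ ⟨P, hP, hmean, rfl⟩
  refine (entropy_le_tsum _ _ hpos).trans ?_
  -- The equality case of Gibbs: the entropy of `CPo(λ,Q)` is its own mean of `G`.
  rw [entropy_eq_tsum]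
  set G : ℕ → ℝ≥0∞ := fun x => ENNReal.ofReal (-Real.log (compoundPoisson r Q x).toReal)
  have hG : ∀ s a b, G (a + s) + G (b + s) ≤ G s + G (a + (b + s)) := by
    intro s a b
    simp only [G]
    rw [← ENNReal.ofReal_add (neg_log_nonneg _ _) (neg_log_nonneg _ _),
      ← ENNReal.ofReal_add (neg_log_nonneg _ _) (neg_log_nonneg _ _)]
    exact ENNReal.ofReal_le_ofReal (add_le_add_of_convex
      (f := fun x => -Real.log (compoundPoisson r Q x).toReal) (two_mul_neg_log_le hCPo hpos) s a b)
  change ∑' x, P.bind (convPow Q) x * G x ≤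
    ∑' x, (ProbabilityTheory.poissonMeasure r).toPMF.bind (convPow Q) x * G x
  rw [tsum_bind_mul, tsum_bind_mul]
  exact tsum_mul_le_tsum_poisson_mul hr hP hmean (two_mul_tsum_convPow_le Q hG)
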